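/- Let $\mathbf{Pol}$ be the category of Polish spaces (separable, completely metrizable topological spaces) and continuous maps. Let $\mathsf{G}:\mathbf{Pol}\to\mathbf{Pol}$ be the functor underlying the Giry monad: $\mathsf{G}X$ is the set of Borel probability measures on $X$ with the topology of weak convergence (which is Polish), and $\mathsf{G}f:\mathsf{G}X\to\mathsf{G}Y$ is the pushforward $\mu\mapsto f_*\mu$ for continuous $f:X\to Y$. Let $\mathsf{G}\times\mathsf{G}$ be the product functor $X\mapsto \mathsf{G}X\times\mathsf{G}X$ (product topology). **Theorem.** The natural transformations $\mathsf{G}\times\mathsf{G}\to\mathsf{G}$ are exactly the convex combinations $+^\lambda$, $\lambda\in[0,1]$. That is: 1. for every $\lambda\in[0,1]$ there is exactly one natural transformation $+^\lambda:\mathsf{G}\times\mathsf{G}\to\mathsf{G}$ whose components $+^\lambda_X:\mathsf{G}X\times\mathsf{G}X\to\mathsf{G}X$ satisfy $$(\mu+^\lambda_X\nu)(A)=\lambda\,\mu(A)+(1-\lambda)\,\nu(A)$$ for every Polish space $X$, all $\mu,\nu\in\mathsf{G}X$ and every Borel subset $A\subseteq X$; 2. for every natural transformation $\alpha:\mathsf{G}\times\mathsf{G}\to\mathsf{G}$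 there is $\lambda\in[0,1]$ (the same for all $X$) with $\alpha=+^\lambda$. -/

import Mathlib

open CategoryTheory MeasureTheory TopologicalSpace Topology Filter Set
open scoped ENNReal NNReal

universe u

namespace GiryPol

section Polish

/-! ### The weak topology on the probability measures of a Polish space is Polish -/

/-- Pushforward along an embedding into a metrizable space is inducing for the weak topologies. -/
theorem isInducing_map {X Y : Type*} [TopologicalSpace X] [MeasurableSpace X] [BorelSpace X]
    [PseudoMetrizableSpace X]
    [TopologicalSpace Y] [MeasurableSpace Y] [BorelSpace Y] [PseudoMetrizableSpace Y]
    [SeparableSpace Y] {f : X → Y} (hf : IsEmbedding f) :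
    IsInducing (fun μ : ProbabilityMeasure X =>
      μ.map (f := f) hf.continuous.measurable.aemeasurable) := by
  set F : ProbabilityMeasure X → ProbabilityMeasure Y := fun μ =>
      μ.map (f := f) hf.continuous.measurable.aemeasurable with hF
  refine isInducing_iff_nhds.2 fun μ => le_antisymm
    ((ProbabilityMeasure.continuous_map hf.continuous).tendsto μ).le_comap ?_
  have key : Tendsto (fun ν : ProbabilityMeasure X => ν) (comap F (𝓝 (F μ))) (𝓝 μ) := by
    refine tendsto_of_forall_isOpen_le_liminf' fun U hU => ?_
    obtain ⟨V, hV, rfl⟩ := hf.isInducing.isOpen_iff.1 hU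
    have h := ProbabilityMeasure.le_liminf_measure_open_of_tendsto
      (tendsto_comap (f := F) (x := 𝓝 (F μ))) hV
    simpa [hF, Measure.map_apply hf.continuous.measurable hV.measurableSet] using h
  exact key

theorem secondCountable_probabilityMeasure (X : Type*) [TopologicalSpace X] [PolishSpace X]
    [MeasurableSpace X] [BorelSpace X] : SecondCountableTopology (ProbabilityMeasure X) := by
  let := upgradeIsCompletelyMetrizable X
  obtain ⟨f, hf⟩ := Metric.PiNatEmbed.exists_embedding_to_hilbert_cube (X := X)
  let : MetricSpace (ProbabilityMeasure (ℕ → unitInterval)) :=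
    metrizableSpaceMetric (ProbabilityMeasure (ℕ → unitInterval))
  have : SecondCountableTopology (ProbabilityMeasure (ℕ → unitInterval)) := inferInstance
  exact (isInducing_map hf).secondCountableTopology

/-- Uniformly small mass outside finite unions of balls of every radius gives tightness. -/
theorem isTightMeasureSet_of_balls {X : Type*} [MetricSpace X] [CompleteSpace X]
    [MeasurableSpace X] [BorelSpace X] (S : Set (ProbabilityMeasure X))
    (h : ∀ ε : ℝ≥0, 0 < ε → ∃ t : Set X, t.Finite ∧ ∀ μ ∈ S,
      (μ : Measure X) (⋃ x ∈ t, Metric.closedBall x ε)ᶜ ≤ ε) :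
    IsTightMeasureSet {((μ : ProbabilityMeasure X) : Measure X) | μ ∈ S} := by
  rw [isTightMeasureSet_iff_exists_isCompact_measure_compl_le]
  intro ε hε
  obtain ⟨δ, hδ, hsum⟩ := ENNReal.exists_pos_sum_of_countable hε.ne' ℕ
  have hδ0 : Tendsto δ atTop (𝓝 0) := by
    have : (∑' i, (δ i : ℝ≥0∞)) ≠ ∞ := (hsum.trans_le le_top).ne
    exact NNReal.tendsto_atTop_zero_of_summable (ENNReal.tsum_coe_ne_top_iff_summable.1 this)
  choose t ht hS using fun n => h (δ n) (hδ n)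
  refine ⟨⋂ n, ⋃ x ∈ t n, Metric.closedBall x (δ n), ?_, ?_⟩
  · refine TotallyBounded.isCompact_of_isClosed ?_ ?_
    · refine Metric.totallyBounded_iff.mpr fun r hr => ?_
      obtain ⟨n, hn⟩ : ∃ n, (δ n : ℝ) < r :=
        (((NNReal.tendsto_coe.2 hδ0).eventually_lt_const hr)).exists
      refine ⟨t n, ht n, (iInter_subset _ n).trans ?_⟩
      exact iUnion₂_mono fun x _ => Metric.closedBall_subset_ball hn
    · exact isClosed_iInter fun n =>
        (ht n).isClosed_biUnion fun _ _ => Metric.isClosed_closedBall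
  · rintro _ ⟨μ, hμ, rfl⟩
    rw [compl_iInter]
    calc _ ≤ ∑' n, (μ : Measure X) (⋃ x ∈ t n, Metric.closedBall x (δ n))ᶜ :=
          measure_iUnion_le _
      _ ≤ ∑' n, (δ n : ℝ≥0∞) := ENNReal.tsum_le_tsum fun n => hS n μ hμ
      _ ≤ ε := hsum.le

theorem completeSpace_levyProkhorov (X : Type*) [MetricSpace X] [CompleteSpace X]
    [SecondCountableTopology X] [MeasurableSpace X] [BorelSpace X] :
    CompleteSpace (LevyProkhorov (ProbabilityMeasure X)) := by
  refine Metric.complete_of_cauchySeq_tendsto fun u hu => ?_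
  let v : ℕ → ProbabilityMeasure X := fun n => (u n).toMeasure
  have htight : IsTightMeasureSet
      {((μ : ProbabilityMeasure X) : Measure X) | μ ∈ range v} := by
    refine isTightMeasureSet_of_balls _ fun ε hε => ?_
    have hε2 : 0 < ε / 2 := half_pos hε
    obtain ⟨N, hN⟩ := EMetric.cauchySeq_iff.1 hu ((ε / 2 : ℝ≥0) : ℝ≥0∞) (by exact_mod_cast hε2)
    have hfin : IsTightMeasureSet
        {((μ : ProbabilityMeasure X) : Measure X) | μ ∈ v '' Iic N} := by
      refine isTightMeasureSet_of_isCompact_closure ?_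
      have := ((finite_Iic N).image v)
      rw [this.isClosed.closure_eq]
      exact this.isCompact
    obtain ⟨K, hK, hKμ⟩ := isTightMeasureSet_iff_exists_isCompact_measure_compl_le.1 hfin
      ((ε / 2 : ℝ≥0) : ℝ≥0∞) (by exact_mod_cast hε2)
    obtain ⟨t, ht, hcov⟩ := Metric.totallyBounded_iff.1 hK.totallyBounded
      ((ε / 2 : ℝ≥0) : ℝ) (by exact_mod_cast hε2)
    have hhalf : ((ε / 2 : ℝ≥0) : ℝ) + ((ε / 2 : ℝ≥0) : ℝ) = ε := by
      push_cast; ring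
    have hhalf' : ((ε / 2 : ℝ≥0) : ℝ≥0∞) + ((ε / 2 : ℝ≥0) : ℝ≥0∞) = ε := by
      rw [← ENNReal.coe_add, add_halves]
    have hthick : Metric.thickening ((ε / 2 : ℝ≥0) : ℝ) K ⊆
        ⋃ x ∈ t, Metric.closedBall x (ε : ℝ) := by
      intro y hy
      obtain ⟨z, hz, hyz⟩ := Metric.mem_thickening_iff.1 hy
      obtain ⟨x, hx, hzx⟩ := mem_iUnion₂.1 (hcov hz)
      refine mem_iUnion₂.2 ⟨x, hx, ?_⟩
      have := Metric.mem_ball.1 hzx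
      rw [Metric.mem_closedBall]
      linarith [dist_triangle y z x]
    refine ⟨t, ht, ?_⟩
    rintro _ ⟨n, rfl⟩
    refine (measure_mono (compl_subset_compl.2 hthick)).trans ?_
    rcases le_total n N with hn | hn
    · refine (measure_mono (compl_subset_compl.2 (Metric.self_subset_thickening
        (by exact_mod_cast hε2) K))).trans ((hKμ _ ⟨v n, ⟨n, hn, rfl⟩, rfl⟩).trans ?_)
      rw [← hhalf']; exact le_self_add
    · have h1 := hN N le_rfl n hn
      rw [LevyProkhorov.edist_probabilityMeasure_def] at h1
      have h2 := left_measure_le_of_levyProkhorovEDist_lt h1 hK.isClosed.measurableSet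
      have h3 := hKμ _ ⟨v N, ⟨N, mem_Iic.2 le_rfl, rfl⟩, rfl⟩
      rw [ENNReal.coe_toReal] at h2
      rw [prob_compl_eq_one_sub Metric.isOpen_thickening.measurableSet]
      rw [prob_compl_eq_one_sub hK.isClosed.measurableSet] at h3
      rw [tsub_le_iff_right] at h3 ⊢
      calc (1 : ℝ≥0∞) ≤ _ := h3
        _ ≤ _ := add_le_add le_rfl h2
        _ = _ := by rw [← hhalf']; ring
  have hcomp := isCompact_closure_of_isTightMeasureSet htight
  obtain ⟨ν, -, φ, hφ, hlim⟩ := hcomp.isSeqCompact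
    (x := v) (fun n => subset_closure (mem_range_self n))
  refine ⟨LevyProkhorov.ofMeasure ν, tendsto_nhds_of_cauchySeq_of_subseq hu
    hφ.tendsto_atTop ?_⟩
  exact (LevyProkhorov.continuous_ofMeasure_probabilityMeasure.tendsto ν).comp hlim

/-- The probability measures on a Polish space form a Polish space for weak convergence. -/
instance polishSpace_probabilityMeasure (X : Type*) [TopologicalSpace X] [PolishSpace X]
    [MeasurableSpace X] [BorelSpace X] : PolishSpace (ProbabilityMeasure X) := by
  have := secondCountable_probabilityMeasure X
  let := upgradeIsCompletelyMetrizable X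
  have := completeSpace_levyProkhorov X
  have : IsCompletelyMetrizableSpace (ProbabilityMeasure X) :=
    (LevyProkhorov.probabilityMeasureHomeomorph
      (Ω := X)).isClosedEmbedding.IsCompletelyMetrizableSpace
  exact {}

end Polish

/-! ### The category of Polish spaces and the Giry functor -/

/-- A Polish space: a separable, completely metrizable topological space. -/
structure Pol where
  carrier : Type u
  [top : TopologicalSpace carrier]
  [polish : PolishSpace carrier]

attribute [instance] Pol.top Pol.polish

instance : CoeSort Pol.{u} (Type u) := ⟨Pol.carrier⟩

/-- A Polish space carries its Borel sets. -/
instance (X : Pol.{u}) : MeasurableSpace X.carrier := borel X.carrier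

instance (X : Pol.{u}) : BorelSpace X.carrier := ⟨rfl⟩

/-- The category of Polish spaces and continuous maps. -/
instance : Category Pol.{u} where
  Hom X Y := C(X, Y)
  id X := ContinuousMap.id X
  comp f g := ContinuousMap.comp g f

/-- The pushforward `G f : G X → G Y`, `μ ↦ f_* μ`. -/
noncomputable def push {X Y : Pol.{u}} (f : C(X, Y)) :
    C(ProbabilityMeasure X, ProbabilityMeasure Y) where
  toFun μ := μ.map f.continuous.measurable.aemeasurable
  continuous_toFun := ProbabilityMeasure.continuous_map f.continuous

theorem push_id (X : Pol.{u}) :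
    push (ContinuousMap.id X) = ContinuousMap.id (ProbabilityMeasure X) := by
  ext μ : 1
  exact Subtype.ext (Measure.map_id (μ := (μ : Measure X)))

theorem push_comp {X Y Z : Pol.{u}} (g : C(Y, Z)) (f : C(X, Y)) :
    push (g.comp f) = (push g).comp (push f) := by
  ext μ : 1
  exact Subtype.ext (Measure.map_map (μ := (μ : Measure X)) g.continuous.measurable
    f.continuous.measurable).symm

/-- The (endofunctor of the) Giry monad: Borel probability measures with the weak topology, and
pushforward of measures. -/
noncomputable def giry : Pol.{u} ⥤ Pol.{u} where
  obj X := ⟨ProbabilityMeasure X⟩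
  map f := push f
  map_id X := push_id X
  map_comp f g := push_comp g f

/-- The product functor `G × G`: pairs of probability measures with the product topology, and
pushforward in both components. -/
noncomputable def giryProd : Pol.{u} ⥤ Pol.{u} where
  obj X := ⟨ProbabilityMeasure X × ProbabilityMeasure X⟩
  map f := ContinuousMap.prodMap (push f) (push f)
  map_id X := by
    change ContinuousMap.prodMap (push (ContinuousMap.id X)) (push (ContinuousMap.id X)) = _
    rw [push_id]; rfl
  map_comp {X Y Z} f g := by
    change ContinuousMap.prodMap (push (ContinuousMap.comp g f)) (push (ContinuousMap.comp g f)) = _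
    rw [push_comp]; rfl

/-- The component at `X` of a natural transformation `G × G → G`, as a continuous map
`G X × G X → G X`. -/
def component (α : giryProd.{u} ⟶ giry.{u}) (X : Pol.{u}) :
    C(ProbabilityMeasure X × ProbabilityMeasure X, ProbabilityMeasure X) :=
  α.app X

/-- The natural transformation `α` is the convex combination with weight `l`:
`α_X(μ, ν)(A) = l μ(A) + (1 - l) ν(A)` for all Polish spaces `X`, all `μ, ν ∈ G X`, and all
Borel sets `A ⊆ X`. -/
def IsConvexCombination (l : ℝ) (α : giryProd.{u} ⟶ giry.{u}) : Prop :=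
  ∀ (X : Pol.{u}) (μ ν : ProbabilityMeasure X) (A : Set X), MeasurableSet A →
    ((component α X (μ, ν) A : ℝ≥0) : ℝ) = l * (μ A : ℝ) + (1 - l) * (ν A : ℝ)

end GiryPol

namespace GiryPol

/-! On a discrete space every indicator is a continuous map to two points. By naturality the mass
that `α` gives to `A` is then `φ (μ A) (ν A)`, with one function `φ` for all discrete spaces.
Additivity of measures, tested on three points, makes `φ` additive; being bounded, it is linear in
each variable, and total mass `1` forces `φ 1 0 + φ 0 1 = 1`. So `α` is the convex combination with
weight `φ 1 0` (`exists_component_eq_mix_of_discrete`).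

On a general Polish space indicators are not continuous. There the identity is a pointwise limit of
simple functions. Pushforwards along these come from finite discrete spaces, where `α` is known, and
converge weakly to the given measures. Continuity of `α` and of `mix` gives the formula in the limit
(`component_eq_mix`). -/

/-- A bounded additive function on the unit interval is linear. -/
theorem eq_mul_of_additive_on_unitInterval (g : ℝ → ℝ)
    (hadd : ∀ a b, 0 ≤ a → 0 ≤ b → a + b ≤ 1 → g (a + b) = g a + g b)
    (hbound : ∀ a, 0 ≤ a → a ≤ 1 → |g a| ≤ 1) {a : ℝ} (ha : 0 ≤ a) (ha' : a ≤ 1) :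
    g a = a * g 1 := by
  have hone := abs_le.1 (hbound 1 zero_le_one le_rfl)
  -- The error `g a - a * g 1` is at most `2` in absolute value, and doubling the argument doubles
  -- it; iterating forces it to vanish without any continuity of `g`.
  have key : ∀ n : ℕ, ∀ a, 0 ≤ a → a ≤ 1 → |g a - a * g 1| ≤ 2 * (1 / 2) ^ n := by
    intro n
    induction n with
    | zero =>
      intro a ha ha'
      have h := abs_le.1 (hbound a ha ha')
      rw [abs_le]
      constructor <;> nlinarith
    | succ n ih =>
      have half : ∀ a, 0 ≤ a → a ≤ 1 / 2 → |g a - a * g 1| ≤ 2 * (1 / 2) ^ (n + 1) := by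
        intro a ha ha'
        have h := ih (a + a) (by linarith) (by linarith)
        rw [hadd a a ha ha (by linarith),
          show g a + g a - (a + a) * g 1 = 2 * (g a - a * g 1) by ring, abs_mul, abs_two] at h
        rw [pow_succ]
        linarith
      intro a ha ha'
      rcases le_total a (1 / 2) with h | h
      · exact half a ha h
      -- The errors at `a` and `1 - a` are opposite, since `g a + g (1 - a) = g 1`.
      · have h1 := half (1 - a) (by linarith) (by linarith)
        have h2 := hadd a (1 - a) ha (by linarith) (by linarith)
        rw [add_sub_cancel] at h2
        rwa [show g (1 - a) - (1 - a) * g 1 = -(g a - a * g 1) by rw [h2]; ring, abs_neg] at h1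
  have hlim : Tendsto (fun n : ℕ => 2 * (1 / 2 : ℝ) ^ n) atTop (𝓝 0) := by
    simpa using (tendsto_pow_atTop_nhds_zero_of_lt_one (r := (1 / 2 : ℝ))
      (by norm_num) (by norm_num)).const_mul 2
  have h0 := ge_of_tendsto' hlim fun n => key n a ha ha'
  exact sub_eq_zero.1 (abs_eq_zero.1 (le_antisymm h0 (abs_nonneg _)))

/-! ### Convex combinations -/

section Mix

variable {X : Type*} [MeasurableSpace X]

/-- The convex combination `l μ + (1 - l) ν` of two probability measures. -/
noncomputable def mix (l : unitInterval) (μ ν : ProbabilityMeasure X) : ProbabilityMeasure X :=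
  ⟨ENNReal.ofReal l • (μ : Measure X) + ENNReal.ofReal (1 - l) • (ν : Measure X), ⟨by
    simp only [Measure.coe_add, Measure.coe_smul, Pi.add_apply, Pi.smul_apply, measure_univ,
      smul_eq_mul, mul_one]
    rw [← ENNReal.ofReal_add l.2.1 (sub_nonneg.2 l.2.2), add_sub_cancel, ENNReal.ofReal_one]⟩⟩

theorem mix_apply (l : unitInterval) (μ ν : ProbabilityMeasure X) (A : Set X) :
    ((mix l μ ν A : ℝ≥0) : ℝ) = l * (μ A : ℝ) + (1 - l) * (ν A : ℝ) := by
  change (((ENNReal.ofReal l • (μ : Measure X) + ENNReal.ofReal (1 - l) • (ν : Measure X)) A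
    : ℝ≥0∞)).toReal = l * ((μ : Measure X) A).toReal + (1 - l) * ((ν : Measure X) A).toReal
  simp only [Measure.coe_add, Measure.coe_smul, Pi.add_apply, Pi.smul_apply, smul_eq_mul]
  rw [ENNReal.toReal_add (by finiteness) (by finiteness), ENNReal.toReal_mul, ENNReal.toReal_mul,
    ENNReal.toReal_ofReal l.2.1, ENNReal.toReal_ofReal (sub_nonneg.2 l.2.2)]

theorem probabilityMeasure_ext_real {μ ν : ProbabilityMeasure X}
    (h : ∀ A, MeasurableSet A → (μ A : ℝ) = ν A) : μ = ν :=
  ProbabilityMeasure.eq_of_forall_apply_eq μ ν fun A hA => NNReal.coe_injective (h A hA)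

theorem integral_mix (l : unitInterval) (μ ν : ProbabilityMeasure X) {f : X → ℝ}
    (hμ : Integrable f (μ : Measure X)) (hν : Integrable f (ν : Measure X)) :
    ∫ x, f x ∂(mix l μ ν : Measure X) = l * ∫ x, f x ∂(μ : Measure X)
      + (1 - l) * ∫ x, f x ∂(ν : Measure X) := by
  change ∫ x, f x ∂(ENNReal.ofReal l • (μ : Measure X)
    + ENNReal.ofReal (1 - l) • (ν : Measure X)) = _
  rw [integral_add_measure (hμ.smul_measure (by finiteness)) (hν.smul_measure (by finiteness)),
    integral_smul_measure, integral_smul_measure, ENNReal.toReal_ofReal l.2.1,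
    ENNReal.toReal_ofReal (sub_nonneg.2 l.2.2), smul_eq_mul, smul_eq_mul]

theorem map_mix {Y : Type*} [MeasurableSpace Y] (l : unitInterval) (μ ν : ProbabilityMeasure X)
    {f : X → Y} (hf : Measurable f) :
    (mix l μ ν).map hf.aemeasurable = mix l (μ.map hf.aemeasurable) (ν.map hf.aemeasurable) := by
  refine probabilityMeasure_ext_real fun A hA => ?_
  simp only [mix_apply, ProbabilityMeasure.map_apply _ _ hA]

/-- Weak convergence is tested on integrals of bounded continuous functions, and by `integral_mix`
these combine linearly. -/
theorem continuous_mix [TopologicalSpace X] [BorelSpace X] (l : unitInterval) :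
    Continuous fun p : ProbabilityMeasure X × ProbabilityMeasure X => mix l p.1 p.2 := by
  refine continuous_iff_continuousAt.2 fun p => ?_
  refine ProbabilityMeasure.tendsto_iff_forall_integral_tendsto.2 fun f => ?_
  have h1 := ProbabilityMeasure.tendsto_iff_forall_integral_tendsto.1 (continuous_fst.tendsto p) f
  have h2 := ProbabilityMeasure.tendsto_iff_forall_integral_tendsto.1 (continuous_snd.tendsto p) f
  simp only [integral_mix l _ _ (f.integrable _) (f.integrable _)]
  exact (h1.const_mul _).add (h2.const_mul _)

/-- Pushforwards along pointwise convergent maps converge weakly. -/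
theorem tendsto_map_of_tendsto [TopologicalSpace X] [BorelSpace X]
    {f : ℕ → X → X} (hf : ∀ n, Measurable (f n))
    (hlim : ∀ x, Tendsto (fun n => f n x) atTop (𝓝 x)) (μ : ProbabilityMeasure X) :
    Tendsto (fun n => μ.map (hf n).aemeasurable) atTop (𝓝 μ) := by
  refine ProbabilityMeasure.tendsto_iff_forall_integral_tendsto.2 fun φ => ?_
  have h : ∀ n, ∫ x, φ x ∂(μ.map (hf n).aemeasurable : Measure X)
      = ∫ x, φ (f n x) ∂(μ : Measure X) := fun n =>
    integral_map (hf n).aemeasurable φ.continuous.measurable.aestronglyMeasurable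
  simp only [h]
  refine tendsto_integral_of_dominated_convergence (fun _ => ‖φ‖) (fun n =>
    (φ.continuous.measurable.comp (hf n)).aestronglyMeasurable) (integrable_const _)
    (fun n => ae_of_all _ fun x => φ.norm_coe_le_norm _)
    (ae_of_all _ fun x => (φ.continuous.tendsto x).comp (hlim x))

end Mix

/-- The convex combination with weight `l` as a natural transformation. -/
noncomputable def mixTrans (l : unitInterval) : giryProd.{u} ⟶ giry.{u} where
  app X := (⟨fun p => mix l p.1 p.2, continuous_mix l⟩ :
    C(ProbabilityMeasure X × ProbabilityMeasure X, ProbabilityMeasure X))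
  naturality _ _ f := ContinuousMap.ext fun p =>
    (map_mix l p.1 p.2 (ContinuousMap.continuous f).measurable).symm

theorem isConvexCombination_mixTrans (l : unitInterval) :
    IsConvexCombination l (mixTrans.{u} l) := fun _ μ ν A _ => mix_apply l μ ν A

theorem IsConvexCombination.unique {l : ℝ} {α β : giryProd.{u} ⟶ giry.{u}}
    (hα : IsConvexCombination l α) (hβ : IsConvexCombination l β) : α = β := by
  refine NatTrans.ext (funext fun X => ContinuousMap.ext fun p => ?_)
  exact probabilityMeasure_ext_real fun A hA =>
    (hα X p.1 p.2 A hA).trans (hβ X p.1 p.2 A hA).symm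

/-! ### Natural transformations on discrete spaces -/

theorem component_push (α : giryProd.{u} ⟶ giry.{u}) {X Y : Pol.{u}} (f : C(X, Y))
    (μ ν : ProbabilityMeasure X) :
    component α Y (push f μ, push f ν) = push f (component α X (μ, ν)) :=
  congrArg (fun h : C(ProbabilityMeasure X × ProbabilityMeasure X, ProbabilityMeasure Y) => h (μ, ν))
    (α.naturality (X := X) (Y := Y) f)

theorem push_apply {X Y : Pol.{u}} (f : C(X, Y)) (μ : ProbabilityMeasure X) {A : Set Y}
    (hA : MeasurableSet A) : push f μ A = μ (f ⁻¹' A) :=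
  ProbabilityMeasure.map_apply _ f.continuous.measurable.aemeasurable hA

/-- The discrete space with `n` points. -/
def finPol (n : ℕ) : Pol.{u} :=
  letI : TopologicalSpace (ULift.{u} (Fin n)) := ⊥
  haveI : DiscreteTopology (ULift.{u} (Fin n)) := ⟨rfl⟩
  ⟨ULift.{u} (Fin n)⟩

instance (n : ℕ) : DiscreteTopology (finPol.{u} n) := ⟨rfl⟩

instance (n : ℕ) : Finite (finPol.{u} n) := inferInstanceAs (Finite (ULift.{u} (Fin n)))

/-- The points of `finPol n`. -/
def finPol.mk {n : ℕ} (i : Fin n) : finPol.{u} n := ULift.up i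

theorem finPol.mk_injective {n : ℕ} : Function.Injective (finPol.mk.{u} (n := n)) :=
  ULift.up_injective

theorem finPol.exists_mk {n : ℕ} (x : finPol.{u} n) : ∃ i, finPol.mk i = x := ⟨ULift.down x, rfl⟩

theorem measurableSet_of_discrete {X : Pol.{u}} [DiscreteTopology X] (A : Set X) :
    MeasurableSet A := (isOpen_discrete A).measurableSet

/-- The measure on three points with masses `a`, `b` and `1 - a - b`. -/
theorem exists_three_point_measure {a b : ℝ} (ha : 0 ≤ a) (hb : 0 ≤ b) (hab : a + b ≤ 1) :
    ∃ μ : ProbabilityMeasure (finPol.{u} 3),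
      (μ {finPol.mk 0} : ℝ) = a ∧ (μ {finPol.mk 1} : ℝ) = b ∧
      (μ {finPol.mk 0, finPol.mk 1} : ℝ) = a + b := by
  let δ : Fin 3 → Measure (finPol.{u} 3) := fun i => Measure.dirac (finPol.mk i)
  let m : Measure (finPol.{u} 3) := ENNReal.ofReal a • δ 0 + ENNReal.ofReal b • δ 1
    + ENNReal.ofReal (1 - (a + b)) • δ 2
  have hm : ∀ A, m A = ENNReal.ofReal a * A.indicator 1 (finPol.mk 0)
      + ENNReal.ofReal b * A.indicator 1 (finPol.mk 1)
      + ENNReal.ofReal (1 - (a + b)) * A.indicator 1 (finPol.mk 2) := fun A => by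
    simp [m, δ, Measure.dirac_apply' _ (measurableSet_of_discrete A)]
  have hp : IsProbabilityMeasure m := ⟨by
    rw [hm]
    simp only [indicator_univ, Pi.one_apply, mul_one]
    rw [← ENNReal.ofReal_add ha hb, ← ENNReal.ofReal_add (by linarith) (by linarith)]
    simp⟩
  refine ⟨⟨m, hp⟩, ?_, ?_, ?_⟩
  · change (m _).toReal = a
    rw [hm]
    simp [finPol.mk_injective.eq_iff, ha]
  · change (m _).toReal = b
    rw [hm]
    simp [finPol.mk_injective.eq_iff, hb]
  · change (m _).toReal = a + b
    rw [hm]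
    simp [finPol.mk_injective.eq_iff, ← ENNReal.ofReal_add ha hb, add_nonneg ha hb]

/-- On discrete spaces, the mass that a natural transformation gives to a set depends only on the
masses of this set. -/
theorem component_apply_congr (α : giryProd.{u} ⟶ giry.{u}) {X Y : Pol.{u}}
    [DiscreteTopology X] [DiscreteTopology Y] {μ ν : ProbabilityMeasure X}
    {μ' ν' : ProbabilityMeasure Y} {A : Set X} {B : Set Y} (hμ : (μ A : ℝ) = μ' B)
    (hν : (ν A : ℝ) = ν' B) :
    (component α X (μ, ν) A : ℝ) = component α Y (μ', ν') B := by
  classical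
  -- Both pairs of measures are compared through their images on two points, where a probability
  -- measure is determined by the mass of one point.
  let χ (Z : Pol.{u}) [DiscreteTopology Z] (C : Set Z) : C(Z, finPol.{u} 2) :=
    ⟨fun z => if z ∈ C then finPol.mk 0 else finPol.mk 1, continuous_of_discreteTopology⟩
  have hχ (Z : Pol.{u}) [DiscreteTopology Z] (C : Set Z) : χ Z C ⁻¹' {finPol.mk 0} = C := by
    ext z
    by_cases hz : z ∈ C <;> simp [χ, hz, finPol.mk_injective.eq_iff]
  have hpush (Z : Pol.{u}) [DiscreteTopology Z] (C : Set Z) (ρ : ProbabilityMeasure Z) :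
      push (χ Z C) ρ {finPol.mk 0} = ρ C := by
    rw [push_apply _ _ (measurableSet_of_discrete _), hχ]
  have heq {ρ : ProbabilityMeasure X} {ρ' : ProbabilityMeasure Y} (h : (ρ A : ℝ) = ρ' B) :
      push (χ X A) ρ = push (χ Y B) ρ' := by
    have h0 : push (χ X A) ρ {finPol.mk 0} = push (χ Y B) ρ' {finPol.mk 0} := by
      rw [hpush, hpush]
      exact NNReal.coe_injective h
    have h0' : (push (χ X A) ρ : Measure (finPol.{u} 2)) {finPol.mk 0}
        = (push (χ Y B) ρ' : Measure (finPol.{u} 2)) {finPol.mk 0} := by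
      rw [← ProbabilityMeasure.ennreal_coeFn_eq_coeFn_toMeasure,
        ← ProbabilityMeasure.ennreal_coeFn_eq_coeFn_toMeasure, h0]
    have hc : ({finPol.mk 1} : Set (finPol.{u} 2)) = {finPol.mk 0}ᶜ := by
      ext x
      obtain ⟨i, rfl⟩ := finPol.exists_mk x
      fin_cases i <;> simp [finPol.mk_injective.eq_iff]
    refine Subtype.ext (Measure.ext_of_singleton fun x => ?_)
    obtain ⟨i, rfl⟩ := finPol.exists_mk x
    fin_cases i
    · exact h0'
    · change (push (χ X A) ρ : Measure (finPol.{u} 2)) {finPol.mk 1}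
        = (push (χ Y B) ρ' : Measure (finPol.{u} 2)) {finPol.mk 1}
      rw [hc, prob_compl_eq_one_sub (measurableSet_of_discrete _),
        prob_compl_eq_one_sub (measurableSet_of_discrete _)]
      exact congrArg _ h0'
  rw [← hpush X A, ← hpush Y B, ← component_push, ← component_push, heq hμ, heq hν]

/-- On discrete spaces, a natural transformation is a convex combination. -/
theorem exists_component_eq_mix_of_discrete (α : giryProd.{u} ⟶ giry.{u}) :
    ∃ l : unitInterval, ∀ (X : Pol.{u}) [DiscreteTopology X] (μ ν : ProbabilityMeasure X),
      component α X (μ, ν) = mix l μ ν := by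
  -- The bounds on `a` sit inside the existential so that the choice `P` is defined on all of `ℝ`;
  -- its values outside `[0, 1]` are irrelevant.
  have hex : ∀ a : ℝ, ∃ μ : ProbabilityMeasure (finPol.{u} 3),
      0 ≤ a → a ≤ 1 → (μ {finPol.mk 0} : ℝ) = a := by
    intro a
    by_cases ha : 0 ≤ a ∧ a ≤ 1
    · obtain ⟨μ, h, -⟩ := exists_three_point_measure.{u} ha.1 le_rfl (by simpa using ha.2)
      exact ⟨μ, fun _ _ => h⟩
    · obtain ⟨μ, -⟩ := exists_three_point_measure.{u} le_rfl le_rfl (by simp)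
      exact ⟨μ, fun h h' => (ha ⟨h, h'⟩).elim⟩
  choose P hP using hex
  let φ : ℝ → ℝ → ℝ := fun a b => component α (finPol.{u} 3) (P a, P b) {finPol.mk 0}
  have hφ (X : Pol.{u}) [DiscreteTopology X] (μ ν : ProbabilityMeasure X) (A : Set X) :
      (component α X (μ, ν) A : ℝ) = φ (μ A) (ν A) := by
    refine component_apply_congr α ?_ ?_ <;>
      exact (hP _ (NNReal.coe_nonneg _)
        (by exact_mod_cast ProbabilityMeasure.apply_le_one _ _)).symm
  have hφ0 : ∀ a b, 0 ≤ φ a b := fun a b => NNReal.coe_nonneg _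
  have hφ1 : ∀ a b, φ a b ≤ 1 := fun a b => by
    exact_mod_cast ProbabilityMeasure.apply_le_one _ _
  have habs : ∀ a b, |φ a b| ≤ 1 := fun a b => by
    rw [abs_of_nonneg (hφ0 a b)]
    exact hφ1 a b
  have hadd : ∀ a b a' b', 0 ≤ a → 0 ≤ b → 0 ≤ a' → 0 ≤ b' → a + a' ≤ 1 → b + b' ≤ 1 →
      φ (a + a') (b + b') = φ a b + φ a' b' := by
    intro a b a' b' ha hb ha' hb' haa hbb
    -- Two points carry the summands, and the third absorbs the remaining mass.
    obtain ⟨μ, hμ0, hμ1, hμ⟩ := exists_three_point_measure.{u} ha ha' haa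
    obtain ⟨ν, hν0, hν1, hν⟩ := exists_three_point_measure.{u} hb hb' hbb
    rw [← hμ, ← hν, ← hφ]
    subst hμ0 hν0 hμ1 hν1
    rw [← hφ, ← hφ, ← NNReal.coe_add]
    have hdisj : Disjoint ({finPol.mk 0} : Set (finPol.{u} 3)) {finPol.mk 1} := by
      simp [finPol.mk_injective.eq_iff]
    have h := measure_union (μ := (component α (finPol.{u} 3) (μ, ν) : Measure (finPol.{u} 3)))
      hdisj (measurableSet_of_discrete _)
    rw [singleton_union] at h
    simp only [← ProbabilityMeasure.ennreal_coeFn_eq_coeFn_toMeasure] at h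
    exact_mod_cast h
  have hsum : φ 1 0 + φ 0 1 = 1 := by
    rw [← hadd 1 0 0 1 (by simp) (by simp) (by simp) (by simp) (by simp) (by simp)]
    -- The whole space has mass `1`, so `φ 1 1 = 1`; `P 0` is an arbitrary choice of measure.
    simpa using (hφ (finPol.{u} 3) (P 0) (P 0) univ).symm
  refine ⟨⟨φ 1 0, hφ0 _ _, hφ1 _ _⟩, fun X _ μ ν => probabilityMeasure_ext_real fun A _ => ?_⟩
  have hμ0 : (0 : ℝ) ≤ μ A := NNReal.coe_nonneg _
  have hν0 : (0 : ℝ) ≤ ν A := NNReal.coe_nonneg _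
  have hμ1 : (μ A : ℝ) ≤ 1 := by exact_mod_cast ProbabilityMeasure.apply_le_one _ _
  have hν1 : (ν A : ℝ) ≤ 1 := by exact_mod_cast ProbabilityMeasure.apply_le_one _ _
  have h1 := eq_mul_of_additive_on_unitInterval (fun a => φ a 0) (fun a b ha hb hab => by
    simpa using hadd a 0 b 0 ha le_rfl hb le_rfl hab (by simp)) (fun a _ _ => habs a 0) hμ0 hμ1
  have h2 := eq_mul_of_additive_on_unitInterval (fun b => φ 0 b) (fun a b ha hb hab => by
    simpa using hadd 0 a 0 b le_rfl ha le_rfl hb (by simp) hab) (fun b _ _ => habs 0 b) hν0 hν1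
  have h3 := hadd (μ A) 0 0 (ν A) hμ0 le_rfl le_rfl hν0 (by rwa [add_zero]) (by rwa [zero_add])
  rw [add_zero, zero_add] at h3
  rw [mix_apply, hφ, h3, h1, h2]
  change _ = φ 1 0 * (μ A : ℝ) + (1 - φ 1 0) * (ν A : ℝ)
  linear_combination (ν A : ℝ) * hsum

/-! ### Approximation by finitely supported measures -/

/-- Natural transformations which agree with a convex combination on discrete spaces agree with
it on the images of measures under maps which factor through a discrete space. -/
theorem component_map_of_factors {α : giryProd.{u} ⟶ giry.{u}} {l : unitInterval}
    (h : ∀ (X : Pol.{u}) [DiscreteTopology X] (μ ν : ProbabilityMeasure X),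
      component α X (μ, ν) = mix l μ ν)
    {X F : Pol.{u}} [DiscreteTopology F] (ι : C(F, X)) {g : X → F}
    (hg : ∀ s, MeasurableSet (g ⁻¹' s)) {f : X → X} (hf : Measurable f) (hfg : f = ι ∘ g)
    (μ ν : ProbabilityMeasure X) :
    component α X (μ.map hf.aemeasurable, ν.map hf.aemeasurable)
      = mix l (μ.map hf.aemeasurable) (ν.map hf.aemeasurable) := by
  have hg' : Measurable g := fun s _ => hg s
  -- As `g` is only measurable, naturality cannot be applied to it; it is applied to the continuous
  -- `ι` alone.
  have key : ∀ ρ : ProbabilityMeasure X,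
      ρ.map hf.aemeasurable = push ι (ρ.map hg'.aemeasurable) := fun ρ => by
    subst hfg
    exact Subtype.ext (Measure.map_map (μ := (ρ : Measure X)) ι.continuous.measurable hg').symm
  rw [key, key, component_push, h F]
  exact map_mix l _ _ ι.continuous.measurable

/-- A simple function factors through its range, which is finite and Hausdorff, hence discrete, and
whose inclusion is continuous. -/
theorem component_map_simpleFunc {α : giryProd.{u} ⟶ giry.{u}} {l : unitInterval}
    (h : ∀ (X : Pol.{u}) [DiscreteTopology X] (μ ν : ProbabilityMeasure X),
      component α X (μ, ν) = mix l μ ν)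
    (X : Pol.{u}) (f : SimpleFunc X X) (μ ν : ProbabilityMeasure X) :
    component α X (μ.map f.measurable.aemeasurable, ν.map f.measurable.aemeasurable)
      = mix l (μ.map f.measurable.aemeasurable) (ν.map f.measurable.aemeasurable) := by
  have : DiscreteTopology (Pol.mk f.range).carrier := inferInstanceAs (DiscreteTopology f.range)
  refine component_map_of_factors h (F := ⟨f.range⟩) ⟨Subtype.val, continuous_subtype_val⟩
    (g := fun x => ⟨f x, f.mem_range_self x⟩) (fun s => ?_) f.measurable rfl μ ν
  convert f.measurableSet_preimage (Subtype.val '' s) using 1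
  ext x
  simp

theorem component_eq_mix {α : giryProd.{u} ⟶ giry.{u}} {l : unitInterval}
    (h : ∀ (X : Pol.{u}) [DiscreteTopology X] (μ ν : ProbabilityMeasure X),
      component α X (μ, ν) = mix l μ ν)
    (X : Pol.{u}) (μ ν : ProbabilityMeasure X) : component α X (μ, ν) = mix l μ ν := by
  let := upgradeIsCompletelyMetrizable X
  -- A space with a probability measure is nonempty, which supplies the base point of `approxOn`.
  obtain ⟨x₀⟩ := μ.nonempty
  let f : ℕ → SimpleFunc X X := SimpleFunc.approxOn id measurable_id univ x₀ (mem_univ _)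
  have hf : ∀ x, Tendsto (fun n => f n x) atTop (𝓝 x) := fun x =>
    SimpleFunc.tendsto_approxOn measurable_id (mem_univ _) (by simp)
  have hlim := (tendsto_map_of_tendsto (fun n => (f n).measurable) hf μ).prodMk_nhds
    (tendsto_map_of_tendsto (fun n => (f n).measurable) hf ν)
  -- Both sides are limits of the same sequence in a Hausdorff space.
  refine tendsto_nhds_unique (((component α X).continuous.tendsto _).comp hlim) ?_
  refine (((continuous_mix l).tendsto _).comp hlim).congr fun n => ?_
  exact (component_map_simpleFunc h X (f n) μ ν).symm

end GiryPol

theorem mainTheorem4 :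
    (∀ l : ℝ, l ∈ Set.Icc (0 : ℝ) 1 →
      ∃! α : GiryPol.giryProd.{u} ⟶ GiryPol.giry.{u}, GiryPol.IsConvexCombination l α) ∧
    (∀ α : GiryPol.giryProd.{u} ⟶ GiryPol.giry.{u},
      ∃ l : ℝ, l ∈ Set.Icc (0 : ℝ) 1 ∧ GiryPol.IsConvexCombination l α) := by
  refine ⟨fun l hl => ⟨GiryPol.mixTrans ⟨l, hl⟩,
    GiryPol.isConvexCombination_mixTrans ⟨l, hl⟩, fun β hβ =>
      hβ.unique (GiryPol.isConvexCombination_mixTrans ⟨l, hl⟩)⟩, fun α => ?_⟩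
  obtain ⟨l, h⟩ := GiryPol.exists_component_eq_mix_of_discrete α
  refine ⟨l, l.2, fun X μ ν A _ => ?_⟩
  rw [GiryPol.component_eq_mix h, GiryPol.mix_apply]
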